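/- A *point-line arrangement* on a finite set $P$ of points is a prescribed family $\mathcal S$ of subsets of $P$ with at least three elements each (for instance, a set of triples). A triple of distinct points of $P$ is *prescribed* if it is contained in a member of $\mathcal S$. A *realization* of the arrangement is an injective map $x : P \to \mathbb R^2$ such that, for every triple $T$ of distinct points of $P$, the points of $x(T)$ are collinear if and only if $T$ is prescribed. The arrangement is *real-realizable* if it has a realization, and *rational* if it has a realization all of whose points have rational coordinates. The *Perles configuration* is the arrangement on the nine points $o_1,o_2,o_3,o_4,q_1,q_2,q_3,q_4,c$ with the nine prescribed collinear sets $\{o_1,o_4,q_2,q_3\}$, $\{o_1,o_3,q_4\}$, $\{o_2,o_4,q_1\}$, $\{o_2,q_3,q_4\}$, $\{o_3,q_1,q_2\}$ and $\{o_i,q_i,c\}$ for $i=1,2,3,4$. **Theorem (Grünbaum's Conjecture).** 1. For every $n\le 8$, every real-realizable point-line arrangement on $n$ points is rational. 2. The Perles configuration is real-realizable but not rational. 3. Consequently the Perles configuration has the smallest possible number of points: the least $n$ for which there is a real-realizable arrangement on $n$ points that is not rational is $n=9$. -/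

import Mathlib

/-- A (combinatorial) point-line arrangement with point set `P`: a prescribed family of sets of at
least three points.  The prescribed collinear triples are the three-element subsets of the members
of the family; all other triples are prescribed to be non-collinear.  A list of collinear triples
is the special case in which every member has exactly three points. -/
structure PointLineArrangement (P : Type*) where
  /-- the prescribed collinear sets -/
  collinearSets : Set (Finset P)
  three_le_card : ∀ B ∈ collinearSets, 3 ≤ B.card

namespace PointLineArrangement

variable {P : Type*}

/-- `x` places the points of `A` at distinct points of the Euclidean plane so that precisely the
prescribed triples are collinear. -/
structure IsRealization (A : PointLineArrangement P) (x : P → EuclideanSpace ℝ (Fin 2)) :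
    Prop where
  injective : Function.Injective x
  collinear_iff : ∀ T : Finset P, T.card = 3 →
    (Collinear ℝ (x '' (T : Set P)) ↔ ∃ B ∈ A.collinearSets, T ⊆ B)

/-- `A` has a realization in the real plane. -/
def IsRealizable (A : PointLineArrangement P) : Prop :=
  ∃ x : P → EuclideanSpace ℝ (Fin 2), A.IsRealization x

/-- `A` has a realization in the plane by points both of whose coordinates are rational. -/
def IsRational (A : PointLineArrangement P) : Prop :=
  ∃ x : P → EuclideanSpace ℝ (Fin 2), A.IsRealization x ∧ ∀ p i, ∃ q : ℚ, x p i = (q : ℝ)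

/-- The Perles configuration: nine points on nine lines.  In the picture built from a regular
pentagon with vertices `o₀, …, o₄` and centre `c`, where `qᵢ` is the vertex opposite to `oᵢ` of the
inner pentagon cut out by the diagonals, the labels `0, 1, 2, 3` are `o₁, o₂, o₃, o₄`, the labels
`4, 5, 6, 7` are `q₁, q₂, q₃, q₄`, and `8` is `c`.  The first five lines are the diagonals of the
outer pentagon, the last four are the axes `oᵢ qᵢ c`. -/
def perles : PointLineArrangement (Fin 9) where
  collinearSets :=
    {{0, 3, 5, 6}, {0, 2, 7}, {1, 3, 4}, {1, 6, 7}, {2, 4, 5},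
      {0, 4, 8}, {1, 5, 8}, {2, 6, 8}, {3, 7, 8}}
  three_le_card := by
    intro B hB
    simp only [Set.mem_insert_iff, Set.mem_singleton_iff] at hB
    rcases hB with rfl | rfl | rfl | rfl | rfl | rfl | rfl | rfl | rfl <;> decide

end PointLineArrangement

/-! For at most eight points, a stronger statement is proved by induction on the point set:
arbitrarily near a real configuration there are rational ones with all its collinearities
(`mem_closure_rationalModels`). Distinctness and non-collinearity are open conditions, so a rational
configuration near enough to a realization is a realization too.

If some point lies on at most two lines with three or more points, delete it, approximate the rest,
and put it back: anywhere rational nearby, at a rational parameter on its line, or at the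
intersection of its two lines, which is a rational function of the other points. Otherwise every
point lies on three such lines, and counting leaves only the Fano plane and the Möbius–Kantor
configuration (`exists_fano`, `exists_moebiusKantor`). Neither is real: the first forces 2 = 0, the
second a nontrivial zero of s² - st + t².

The Perles configuration is realized over ℤ[√5], while its collinearities force q² - 3qr + r² = 0
with r ≠ 0, of discriminant 5r², so no realization is rational. -/

namespace PointLineArrangement

/-! ### Signed areas, and two configurations that are not real. -/

section Area

variable {K : Type*}

/-- Twice the signed area of the triangle `p q r`. -/
def area [CommRing K] (p q r : K × K) : K :=
  (q.1 - p.1) * (r.2 - p.2) - (q.2 - p.2) * (r.1 - p.1)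

theorem area_rotate [CommRing K] (p q r : K × K) : area p q r = area q r p := by
  simp only [area]; ring

theorem area_swap [CommRing K] (p q r : K × K) : area p q r = -area q p r := by
  simp only [area]; ring

theorem area_self_left [CommRing K] (p q : K × K) : area p p q = 0 := by
  simp only [area]; ring

theorem area_self_right [CommRing K] (p q : K × K) : area p q q = 0 := by
  simp only [area]; ring

theorem area_self_outer [CommRing K] (p q : K × K) : area p q p = 0 := by
  simp only [area]; ring

/-- Barycentric coordinates with respect to a triangle. -/
theorem exists_barycentric [Field K] {a b c : K × K} (h : area a b c ≠ 0) :
    ∃ f g k : K × K → K, (f a = 1 ∧ f b = 0 ∧ f c = 0) ∧ (g a = 0 ∧ g b = 1 ∧ g c = 0) ∧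
      (k a = 0 ∧ k b = 0 ∧ k c = 1) ∧ ∀ p q r, area p q r = 0 ↔
        f p * (g q * k r - k q * g r) - g p * (f q * k r - k q * f r)
          + k p * (f q * g r - g q * f r) = 0 := by
  refine ⟨fun p => area p b c / area a b c, fun p => area a p c / area a b c,
    fun p => area a b p / area a b c, ?_, ?_, ?_, fun p q r => ?_⟩
  · simp [h, area_self_left, area_self_outer]
  · simp [h, area_self_left, area_self_right]
  · simp [h, area_self_right, area_self_outer]
  · have key : area p b c / area a b c * (area a q c / area a b c * (area a b r / area a b c)
          - area a b q / area a b c * (area a r c / area a b c))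
        - area a p c / area a b c * (area q b c / area a b c * (area a b r / area a b c)
          - area a b q / area a b c * (area r b c / area a b c))
        + area a b p / area a b c * (area q b c / area a b c * (area a r c / area a b c)
          - area a q c / area a b c * (area r b c / area a b c))
        = area p q r / area a b c := by
      field_simp
      simp only [area]
      ring
    rw [key, div_eq_zero_iff, or_iff_left h]

theorem exists_affine_param [Field K] {a b p : K × K} (hab : a ≠ b) (h : area a b p = 0) :
    ∃ t : K, p = a + t • (b - a) := by
  obtain ⟨a1, a2⟩ := a
  obtain ⟨b1, b2⟩ := b
  obtain ⟨p1, p2⟩ := p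
  simp only [area] at h
  by_cases h1 : b1 - a1 = 0
  · have h2 : b2 - a2 ≠ 0 := fun h2 => hab (by rw [sub_eq_zero] at h1 h2; rw [h1, h2])
    refine ⟨(p2 - a2) / (b2 - a2), ?_⟩
    rw [h1] at h
    have h3 : p1 - a1 = 0 := by
      have : (b2 - a2) * (p1 - a1) = 0 := by linear_combination -h
      exact (mul_eq_zero.1 this).resolve_left h2
    ext <;> simp
    · rw [h1]; linear_combination h3
    · field_simp; ring
  · refine ⟨(p1 - a1) / (b1 - a1), ?_⟩
    ext <;> simp <;> field_simp
    · ring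
    · linear_combination h

theorem area_affine_param [CommRing K] (a b p q : K × K) (t : K) :
    area p q (a + t • (b - a)) = (1 - t) * area p q a + t * area p q b := by
  simp only [area, Prod.fst_add, Prod.snd_add, Prod.smul_fst, Prod.smul_snd, Prod.fst_sub,
    Prod.snd_sub, smul_eq_mul]
  ring

theorem area_eq_zero_of_common_line [Field K] {a b c d e : K × K} (hab : a ≠ b)
    (hc : area a b c = 0) (hd : area a b d = 0) (he : area a b e = 0) : area c d e = 0 := by
  obtain ⟨r, rfl⟩ := exists_affine_param hab hc
  obtain ⟨s, rfl⟩ := exists_affine_param hab hd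
  obtain ⟨t, rfl⟩ := exists_affine_param hab he
  simp only [area, Prod.fst_add, Prod.snd_add, Prod.smul_fst, Prod.smul_snd, Prod.fst_sub,
    Prod.snd_sub, smul_eq_mul]
  ring

/-- The Fano plane is not realizable in the real plane. -/
theorem fano_not_realizable {p0 p1 p2 p3 p4 p5 p6 : ℝ × ℝ}
    (h012 : area p0 p1 p2 = 0) (h034 : area p0 p3 p4 = 0) (h056 : area p0 p5 p6 = 0)
    (h135 : area p1 p3 p5 = 0) (h146 : area p1 p4 p6 = 0) (h236 : area p2 p3 p6 = 0)
    (h245 : area p2 p4 p5 = 0) (n013 : area p0 p1 p3 ≠ 0) (n213 : area p2 p1 p3 ≠ 0)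
    (n016 : area p0 p1 p6 ≠ 0) (n413 : area p4 p1 p3 ≠ 0) (n053 : area p0 p5 p3 ≠ 0) :
    False := by
  obtain ⟨f, g, k, ⟨f0, f1, f3⟩, ⟨g0, g1, g3⟩, ⟨k0, k1, k3⟩, hdet⟩ := exists_barycentric n013
  simp only [hdet, ne_eq, f0, f1, f3, g0, g1, g3, k0, k1, k3, zero_mul, one_mul, mul_zero, mul_one, sub_zero,
    zero_sub, add_zero, neg_eq_zero, neg_neg]
    at h012 h034 h056 h135 h146 h236 h245 n213 n016 n413 n053
  rw [h012, h034, h135] at h245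
  -- The other four factors are nonzero by the non-collinearity hypotheses, so this is exactly where
  -- characteristic two is excluded.
  have : 2 * (f p2 * f p4 * k p6 * g p5) = 0 := by
    linear_combination -f p6 * h245 + f p2 * g p5 * h146 + f p2 * f p4 * h056
      - f p4 * k p5 * h236
  simp_all

/-- The Möbius–Kantor configuration is not realizable in the real plane. -/
theorem moebiusKantor_not_realizable {p0 p1 p2 p3 p4 p5 p6 p7 : ℝ × ℝ}
    (h012 : area p0 p1 p2 = 0) (h034 : area p0 p3 p4 = 0) (h056 : area p0 p5 p6 = 0)
    (h713 : area p7 p1 p3 = 0) (h745 : area p7 p4 p5 = 0) (h726 : area p7 p2 p6 = 0)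
    (h235 : area p2 p3 p5 = 0) (h146 : area p1 p4 p6 = 0)
    (n072 : area p0 p7 p2 ≠ 0) (n071 : area p0 p7 p1 ≠ 0) (n073 : area p0 p7 p3 ≠ 0)
    (n074 : area p0 p7 p4 ≠ 0) (n075 : area p0 p7 p5 ≠ 0) (n076 : area p0 p7 p6 ≠ 0)
    (n721 : area p7 p2 p1 ≠ 0) (n023 : area p0 p2 p3 ≠ 0) : False := by
  obtain ⟨f, g, k, ⟨f0, f7, f2⟩, ⟨g0, g7, g2⟩, ⟨k0, k7, k2⟩, hdet⟩ := exists_barycentric n072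
  simp only [hdet, ne_eq, f0, f7, f2, g0, g7, g2, k0, k7, k2, zero_mul, one_mul, mul_zero, mul_one, sub_zero,
    zero_sub, add_zero, neg_eq_zero, neg_neg]
    at h012 h034 h056 h713 h745 h726 h235 h146 n071 n073 n074 n075 n076 n721 n023
  -- A line through `p0` is determined by the ratio g/k, a line through `p7` by f/k: s and t belong
  -- to the lines `p0 p3 p4` and `p0 p5 p6`, u and w to `p7 p1 p3` and `p7 p4 p5`. The two remaining
  -- lines `p2 p3 p5` and `p1 p4 p6` then relate these slopes.
  obtain ⟨s, hs⟩ : ∃ s, g p3 = s * k p3 := ⟨g p3 / k p3, by field_simp⟩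
  obtain ⟨t, ht⟩ : ∃ t, g p5 = t * k p5 := ⟨g p5 / k p5, by field_simp⟩
  obtain ⟨u, hu⟩ : ∃ u, f p1 = u * k p1 := ⟨f p1 / k p1, by field_simp⟩
  obtain ⟨w, hw⟩ : ∃ w, f p4 = w * k p4 := ⟨f p4 / k p4, by field_simp⟩
  have hs4 : g p4 = s * k p4 := mul_left_cancel₀ n073 (by linear_combination -h034 + k p4 * hs)
  have ht6 : g p6 = t * k p6 := mul_left_cancel₀ n075 (by linear_combination -h056 + k p6 * ht)
  have hu3 : f p3 = u * k p3 := mul_left_cancel₀ n071 (by linear_combination -h713 + k p3 * hu)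
  have hw5 : f p5 = w * k p5 := mul_left_cancel₀ n074 (by linear_combination -h745 + k p5 * hw)
  have e1 : u * t - s * w = 0 := by
    refine mul_left_cancel₀ (mul_ne_zero n073 n075) ?_
    rw [hu3, ht, hs, hw5] at h235
    linear_combination h235
  have e2 : u * (s - t) + w * t = 0 := by
    refine mul_left_cancel₀ (mul_ne_zero (mul_ne_zero n071 n074) n076) ?_
    rw [hu, hs4, ht6, h012, hw, h726] at h146
    linear_combination h146
  have hs0 : s ≠ 0 := by rintro rfl; simp_all
  have hu0 : u ≠ 0 := by rintro rfl; simp_all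
  have e3 : s * (s - t) + t ^ 2 = 0 := by
    refine mul_left_cancel₀ hu0 ?_
    linear_combination s * e2 + t * e1
  have : 0 < s ^ 2 := by positivity
  nlinarith [sq_nonneg (s - 2 * t)]

end Area
-- At most eight points with three lines through each.
section Combinatorics

variable {Q T : Type*}

/-- `dir p x` is an invariant of the line through `p` and `x ≠ p`, among the lines through `p`. -/
def IsDirection (dir : Q → Q → T) : Prop :=
  ∀ p x y, p ≠ x → p ≠ y → x ≠ y → dir p x = dir p y → dir x p = dir x y

/-- Every point lies on at least three lines with three or more points. -/
structure ThreeLinesThroughEachPoint (dir : Q → Q → T) : Prop where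
  first : ∀ p, ∃ c d, c ≠ p ∧ d ≠ p ∧ c ≠ d ∧ dir p c = dir p d
  second : ∀ p a b, a ≠ p → b ≠ p → a ≠ b → dir p a = dir p b →
    ∃ c d, c ≠ p ∧ d ≠ p ∧ c ≠ d ∧ dir p c = dir p d ∧ dir p a ≠ dir p c
  third : ∀ p a b a' b', a ≠ p → b ≠ p → a ≠ b → dir p a = dir p b → a' ≠ p → b' ≠ p → a' ≠ b' →
    dir p a' = dir p b' → dir p a ≠ dir p a' →
    ∃ c d, c ≠ p ∧ d ≠ p ∧ c ≠ d ∧ dir p c = dir p d ∧ dir p a ≠ dir p c ∧ dir p a' ≠ dir p c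

variable {dir : Q → Q → T}

theorem mem_of_nodup_of_card_le [Fintype Q] {l : List Q} (hl : l.Nodup)
    (h : Fintype.card Q ≤ l.length) (q : Q) : q ∈ l := by
  classical
  have : l.toFinset = Finset.univ := by
    rw [← Finset.card_eq_iff_eq_univ]
    exact le_antisymm (Finset.card_le_univ _) (by rwa [List.toFinset_card_of_nodup hl])
  rw [← List.mem_toFinset, this]
  exact Finset.mem_univ q

theorem exists_notMem_of_length_lt [Fintype Q] {l : List Q} (h : l.length < Fintype.card Q) :
    ∃ q, q ∉ l := by
  classical
  by_contra! h'
  have := Finset.card_le_card (fun x _ => List.mem_toFinset.2 (h' x) :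
    (Finset.univ : Finset Q) ⊆ l.toFinset)
  have := l.toFinset_card_le
  rw [← Finset.card_univ] at h
  omega

/-- A line of four points through `a` and two further lines of three account for 1 + 3 + 2 + 2 = 8
points, hence for all of them; so `e` lies on one of the further lines. -/
theorem exists_partner_of_four [Fintype Q] (H : ThreeLinesThroughEachPoint dir)
    (hQ : Fintype.card Q ≤ 8) {a b c d e : Q}
    (hab : a ≠ b) (hac : a ≠ c) (had : a ≠ d) (hbc : b ≠ c) (hbd : b ≠ d) (hcd : c ≠ d)
    (hc : dir a b = dir a c) (hd : dir a b = dir a d) (hea : e ≠ a) (he : dir a b ≠ dir a e) :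
    ∃ z, z ≠ a ∧ z ≠ e ∧ dir a b ≠ dir a z ∧ dir a e = dir a z := by
  obtain ⟨f, g, hf, hg, hfg, hl, hn⟩ := H.second a b c hab.symm hac.symm hbc hc
  obtain ⟨f', g', hf', hg', hfg', hl', hn1, hn2⟩ :=
    H.third a b c f g hab.symm hac.symm hbc hc hf hg hfg hl hn
  have := mem_of_nodup_of_card_le (l := [a, b, c, d, f, g, f', g']) (by simp; and_intros <;> grind)
    (by simpa using hQ) e
  simp only [List.mem_cons, List.not_mem_nil, or_false] at this
  rcases this with h | h | h | h | h | h | h | h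
  · grind
  · grind
  · grind
  · grind
  · exact ⟨g, by grind⟩
  · exact ⟨f, by grind⟩
  · exact ⟨g', by grind⟩
  · exact ⟨f', by grind⟩

/-- If a line had four points, take `e` off it. By `exists_partner_of_four` each of the four lines
joining `e` to them has a third point, and these are distinct: 4 + 1 + 4 = 9 points. -/
theorem eq_of_dir_eq [Fintype Q] (hd : IsDirection dir)
    (H : ThreeLinesThroughEachPoint dir) (hQ : Fintype.card Q ≤ 8) {a b c d : Q}
    (hab : a ≠ b) (hac : a ≠ c) (hbc : b ≠ c) (had : a ≠ d) (hbd : b ≠ d)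
    (hc : dir a b = dir a c) (hd' : dir a b = dir a d) : c = d := by
  by_contra hcd
  obtain ⟨e, -, h1, -, -, -, he⟩ := H.second a b c hab.symm hac.symm hbc hc
  have key : ∀ a b c d e : Q, _ := fun a b c d e =>
    exists_partner_of_four H hQ (a := a) (b := b) (c := c) (d := d) (e := e)
  have hb1 := hd a b c
  have hb2 := hd a b d
  have hc1 := hd a c b
  have hc2 := hd a c d
  have hd1 := hd a d b
  have hd2 := hd a d c
  have hbe := hd b a e
  have hce := hd c a e
  have hde := hd d a e
  have heb : e ≠ b := by grind
  have hec : e ≠ c := by grind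
  have hed : e ≠ d := by grind
  obtain ⟨z1, o1, n1, m1, l1⟩ := key a b c d e hab hac had hbc hbd hcd hc hd' h1 he
  obtain ⟨z2, o2, n2, m2, l2⟩ := key b a c d e (by grind) (by grind) (by grind) (by grind)
    (by grind) (by grind) (by grind) (by grind) (by grind) (by grind)
  obtain ⟨z3, o3, n3, m3, l3⟩ := key c a b d e (by grind) (by grind) (by grind) (by grind)
    (by grind) (by grind) (by grind) (by grind) (by grind) (by grind)
  obtain ⟨z4, o4, n4, m4, l4⟩ := key d a b c e (by grind) (by grind) (by grind) (by grind)
    (by grind) (by grind) (by grind) (by grind) (by grind) (by grind)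
  have e1 := hd a e z1
  have e2 := hd b e z2
  have e3 := hd c e z3
  have e4 := hd d e z4
  have g1 := hd e a b
  have g2 := hd e a c
  have g3 := hd e a d
  have g4 := hd e b c
  have g5 := hd e b d
  have g6 := hd e c d
  have := List.Nodup.length_le_card (l := [a, b, c, d, e, z1, z2, z3, z4]) (by simp; and_intros <;> grind)
  simp at this
  omega

theorem ThreeLinesThroughEachPoint.exists_three_pairs (H : ThreeLinesThroughEachPoint dir)
    (p : Q) : ∃ a b c d e f, [p, a, b, c, d, e, f].Nodup ∧ dir p a = dir p b ∧ dir p c = dir p d ∧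
      dir p e = dir p f ∧ dir p a ≠ dir p c ∧ dir p a ≠ dir p e ∧ dir p c ≠ dir p e := by
  obtain ⟨a, b, ha, hb, hab, h1⟩ := H.first p
  obtain ⟨c, d, hc, hd, hcd, h2, n1⟩ := H.second p a b ha hb hab h1
  obtain ⟨e, f, he, hf, hef, h3, n2, n3⟩ := H.third p a b c d ha hb hab h1 hc hd hcd h2 n1
  exact ⟨a, b, c, d, e, f, by simp; and_intros <;> grind, h1, h2, h3, n1, n2, n3⟩

theorem exists_partner_of_seven [Fintype Q] (H : ThreeLinesThroughEachPoint dir)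
    (hQ : Fintype.card Q ≤ 7) {p e : Q} (he : e ≠ p) :
    ∃ z, z ≠ p ∧ z ≠ e ∧ dir p e = dir p z := by
  obtain ⟨a, b, c, d, f, g, hn, h1, h2, h3, -⟩ := H.exists_three_pairs p
  have := mem_of_nodup_of_card_le hn (by simpa using hQ) e
  simp only [List.mem_cons, List.not_mem_nil, or_false] at this
  simp only [List.nodup_cons, List.mem_cons, not_or] at hn
  rcases this with h | h | h | h | h | h | h
  · exact absurd h he
  · exact ⟨b, by grind⟩
  · exact ⟨a, by grind⟩
  · exact ⟨d, by grind⟩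
  · exact ⟨c, by grind⟩
  · exact ⟨g, by grind⟩
  · exact ⟨f, by grind⟩

/-- Apart from `p` and `w`, the six remaining points are exactly the three pairs on the lines
through `p`. -/
theorem exists_partner_of_eight [Fintype Q] (H : ThreeLinesThroughEachPoint dir)
    (hQ : Fintype.card Q ≤ 8) {p w e : Q} (hwp : w ≠ p)
    (hw : ∀ z, z ≠ p → z ≠ w → dir p w ≠ dir p z) (he : e ≠ p) (hew : e ≠ w) :
    ∃ z, z ≠ p ∧ z ≠ e ∧ z ≠ w ∧ dir p e = dir p z := by
  obtain ⟨a, b, c, d, f, g, hn, h1, h2, h3, -⟩ := H.exists_three_pairs p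
  have := mem_of_nodup_of_card_le (l := [w, p, a, b, c, d, f, g])
    (by rw [List.nodup_cons]; refine ⟨?_, hn⟩; simp at hn ⊢; and_intros <;> grind)
    (by simpa using hQ) e
  simp only [List.mem_cons, List.not_mem_nil, or_false] at this
  simp only [List.nodup_cons, List.mem_cons, not_or] at hn
  rcases this with h | h | h | h | h | h | h | h
  · exact absurd h hew
  · exact absurd h he
  · exact ⟨b, by grind⟩
  · exact ⟨a, by grind⟩
  · exact ⟨d, by grind⟩
  · exact ⟨c, by grind⟩
  · exact ⟨g, by grind⟩
  · exact ⟨f, by grind⟩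

theorem dir_of_line [Fintype Q] (hd : IsDirection dir) (H : ThreeLinesThroughEachPoint dir)
    (hQ : Fintype.card Q ≤ 8) {a b c : Q} (hab : a ≠ b) (hac : a ≠ c) (hbc : b ≠ c)
    (h : dir a b = dir a c) : dir b a = dir b c ∧ dir c a = dir c b ∧
      ∀ z, z ≠ a → z ≠ b → z ≠ c → dir a b ≠ dir a z ∧ dir b a ≠ dir b z ∧ dir c a ≠ dir c z := by
  have h1 := hd a b c hab hac hbc h
  have h2 := hd a c b hac hab hbc.symm h.symm
  refine ⟨h1, h2, fun z za zb zc => ⟨fun h' => ?_, fun h' => ?_, fun h' => ?_⟩⟩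
  · exact zc (eq_of_dir_eq hd H hQ hab hac hbc za.symm zb.symm h h').symm
  · exact zc (eq_of_dir_eq hd H hQ hab.symm hbc hac zb.symm za.symm h1 h').symm
  · exact zb (eq_of_dir_eq hd H hQ hac.symm hbc.symm hab zc.symm za.symm h2 h').symm

/-- With at most seven points any two lie on a line of exactly three, so the lines form a Steiner
triple system. Once `p0`, …, `p6` are named, the third point of each remaining line is the only
candidate not already joined to one of the first two by a known line. -/
theorem exists_fano [Fintype Q] (hd : IsDirection dir) (H : ThreeLinesThroughEachPoint dir)
    (hQ : Fintype.card Q ≤ 7) (p0 : Q) : ∃ p1 p2 p3 p4 p5 p6 : Q,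
      [p0, p1, p2, p3, p4, p5, p6].Nodup ∧ dir p0 p1 = dir p0 p2 ∧ dir p0 p3 = dir p0 p4 ∧
      dir p0 p5 = dir p0 p6 ∧ dir p1 p3 = dir p1 p5 ∧ dir p1 p4 = dir p1 p6 ∧
      dir p2 p3 = dir p2 p6 ∧ dir p2 p4 = dir p2 p5 ∧ dir p0 p1 ≠ dir p0 p3 ∧
      dir p0 p1 ≠ dir p0 p6 ∧ dir p2 p1 ≠ dir p2 p3 ∧ dir p4 p1 ≠ dir p4 p3 ∧
      dir p0 p5 ≠ dir p0 p3 := by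
  have line := @dir_of_line Q T dir _ hd H (by omega)
  have par := fun p e : Q => @exists_partner_of_seven Q T dir _ H hQ p e
  obtain ⟨p1, p2, p3, p4, w, w', hn, h012, h034, -, n13, -⟩ := H.exists_three_pairs p0
  simp at hn
  have l012 := line (by grind) (by grind) (by grind) h012
  have l034 := line (by grind) (by grind) (by grind) h034
  obtain ⟨p5, h51, h53, h135⟩ := par p1 p3 (by grind)
  have l135 := line (by grind) (by grind) (by grind) h135
  obtain ⟨p6, h60, h65, h056⟩ := par p0 p5 (by grind)
  have l056 := line (by grind) (by grind) (by grind) h056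
  have hnd : [p0, p1, p2, p3, p4, p5, p6].Nodup := by
    clear line par
    simp
    and_intros <;> grind
  have cover := mem_of_nodup_of_card_le hnd (by simpa using hQ)
  simp only [List.mem_cons, List.not_mem_nil, or_false] at cover
  have hnd' := hnd
  simp at hnd'
  obtain ⟨a, ha1, ha4, h146⟩ := par p1 p4 (by grind)
  obtain ⟨b, hb2, hb3, h236⟩ := par p2 p3 (by grind)
  obtain ⟨c, hc2, hc4, h245⟩ := par p2 p4 (by grind)
  have l146 := line (by grind) ha1.symm ha4.symm h146
  have l236 := line (by grind) hb2.symm hb3.symm h236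
  have l245 := line (by grind) hc2.symm hc4.symm h245
  clear par line
  obtain rfl : a = p6 := by
    rcases cover a with h | h | h | h | h | h | h <;> grind
  obtain rfl : b = a := by
    rcases cover b with h | h | h | h | h | h | h <;> grind
  obtain rfl : c = p5 := by
    rcases cover c with h | h | h | h | h | h | h <;> grind
  exact ⟨p1, p2, p3, p4, c, b, hnd, h012, h034, h056, h135, h146, h236, h245, n13, by grind,
    by grind, by grind, by grind⟩

/-- Three lines of three points through `p` cover seven points. The eighth cannot share a line with
`p` and another point, since that line would be one of the three and have four points. -/
theorem exists_antipodal [Fintype Q] (hd : IsDirection dir) (H : ThreeLinesThroughEachPoint dir)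
    (hQ : Fintype.card Q = 8) (p : Q) :
    ∃ w, w ≠ p ∧ ∀ z, z ≠ p → z ≠ w → dir p w ≠ dir p z := by
  obtain ⟨a, b, c, d, e, f, hn, h1, h2, h3, h4, h5, h6⟩ := H.exists_three_pairs p
  obtain ⟨w, hw⟩ := exists_notMem_of_length_lt (l := [p, a, b, c, d, e, f]) (by simp [hQ])
  have hnd : [w, p, a, b, c, d, e, f].Nodup := List.nodup_cons.2 ⟨hw, hn⟩
  have cover := mem_of_nodup_of_card_le hnd (by simp [hQ])
  simp only [List.mem_cons, List.not_mem_nil, or_false] at cover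
  simp at hnd
  have l1 := (dir_of_line hd H hQ.le (by grind) (by grind) (by grind) h1).2.2 w
  have l2 := (dir_of_line hd H hQ.le (by grind) (by grind) (by grind) h2).2.2 w
  have l3 := (dir_of_line hd H hQ.le (by grind) (by grind) (by grind) h3).2.2 w
  refine ⟨w, by grind, fun z hz hzw h => ?_⟩
  rcases cover z with h | h | h | h | h | h | h | h <;> grind

-- With `p7` antipodal to `p0`, the lines through `p0` and those through `p7` each pair up the other
-- six points. Following the two pairings alternately gives a hexagon `p2 p1 p3 p4 p5 p6`, and the
-- third lines through `p2` and `p1` are then forced.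
set_option maxHeartbeats 1000000 in
theorem exists_moebiusKantor [Fintype Q] (hd : IsDirection dir)
    (H : ThreeLinesThroughEachPoint dir) (hQ : Fintype.card Q = 8) (p0 : Q) :
    ∃ p1 p2 p3 p4 p5 p6 p7 : Q, [p0, p1, p2, p3, p4, p5, p6, p7].Nodup ∧
      dir p0 p1 = dir p0 p2 ∧ dir p0 p3 = dir p0 p4 ∧ dir p0 p5 = dir p0 p6 ∧
      dir p7 p1 = dir p7 p3 ∧ dir p7 p4 = dir p7 p5 ∧ dir p7 p2 = dir p7 p6 ∧
      dir p2 p3 = dir p2 p5 ∧ dir p1 p4 = dir p1 p6 ∧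
      (∀ z, z ≠ p0 → z ≠ p7 → dir p0 p7 ≠ dir p0 z) ∧
      dir p7 p2 ≠ dir p7 p1 ∧ dir p0 p2 ≠ dir p0 p3 := by
  have line := @dir_of_line Q T dir _ hd H hQ.le
  obtain ⟨p7, h70, n0⟩ := exists_antipodal hd H hQ p0
  have n7 : ∀ z, z ≠ p7 → z ≠ p0 → dir p7 p0 ≠ dir p7 z := fun z h1 h2 h =>
    n0 z h2 h1 (hd p7 p0 z h70 h1.symm h2.symm h)
  have par0 := fun e he0 he7 => exists_partner_of_eight (e := e) H hQ.le h70 n0 he0 he7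
  have par7 := fun e he7 he0 => exists_partner_of_eight (e := e) H hQ.le h70.symm n7 he7 he0
  obtain ⟨p1, p2, h10, h20, h12, h012⟩ := H.first p0
  have h17 : p1 ≠ p7 := by grind
  have h27 : p2 ≠ p7 := by grind
  have l012 := line h10.symm h20.symm h12 h012
  obtain ⟨p3, h37, h31, h30, h713⟩ := par7 p1 h17 h10
  have l713 := line h17.symm h37.symm h31.symm h713
  have h32 : p3 ≠ p2 := by grind
  obtain ⟨p4, h40, h43, h47, h034⟩ := par0 p3 h30 h37
  have l034 := line h30.symm h40.symm h43.symm h034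
  have h41 : p4 ≠ p1 := by grind
  have h42 : p4 ≠ p2 := by grind
  obtain ⟨p5, h57, h54, h50, h745⟩ := par7 p4 h47 h40
  have l745 := line h47.symm h57.symm h54.symm h745
  have h51 : p5 ≠ p1 := by grind
  have h53 : p5 ≠ p3 := by grind
  -- If the walk closed up after four points, the two points left over would be paired by both `p0`
  -- and `p7`, putting `p0` and `p7` on one line.
  have h52 : p5 ≠ p2 := by
    rintro rfl
    obtain ⟨r, hr⟩ := exists_notMem_of_length_lt (Q := Q) (l := [p0, p1, p5, p3, p4, p7])
      (by simp [hQ])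
    simp at hr
    obtain ⟨a, ha0, har, ha7, h0ra⟩ := par0 r (by grind) (by grind)
    obtain ⟨b, hb7, hbr, hb0, h7rb⟩ := par7 r (by grind) (by grind)
    have l0ra := line (by grind) ha0.symm har.symm h0ra
    have l7rb := line (by grind) hb7.symm hbr.symm h7rb
    clear par0 par7 line
    have cover := mem_of_nodup_of_card_le (l := [p0, p1, p5, p3, p4, p7, r, a])
      (by simp; and_intros <;> grind) (by simp [hQ]) b
    simp only [List.mem_cons, List.not_mem_nil, or_false] at cover
    rcases cover with h | h | h | h | h | h | h | h <;> grind
  obtain ⟨p6, h60, h65, h67, h056⟩ := par0 p5 h50 h57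
  have l056 := line h50.symm h60.symm h65.symm h056
  have h61 : p6 ≠ p1 := by grind
  have h62 : p6 ≠ p2 := by grind
  have h63 : p6 ≠ p3 := by grind
  have h64 : p6 ≠ p4 := by grind
  have hnd : [p0, p1, p2, p3, p4, p5, p6, p7].Nodup := by
    clear par0 par7 line
    simp
    and_intros <;> grind
  have cover := mem_of_nodup_of_card_le hnd (by simp [hQ])
  simp only [List.mem_cons, List.not_mem_nil, or_false] at cover
  have h726 : dir p7 p2 = dir p7 p6 := by
    obtain ⟨a, ha7, ha2, ha0, h72a⟩ := par7 p2 h27 h20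
    have l72a := line h27.symm ha7.symm ha2.symm h72a
    clear par0 par7 line
    rcases cover a with h | h | h | h | h | h | h | h <;> grind
  have l726 := line h27.symm h67.symm h62.symm h726
  -- The third line through `p2` takes two of `p3`, `p4`, `p5`; the pairs with `p4` already lie on
  -- lines through `p0` or `p7`. The argument at `p1` is the same.
  have h235 : dir p2 p3 = dir p2 p5 := by
    obtain ⟨a, b, ha, hb, hab, h, h', h''⟩ := H.third p2 p0 p1 p7 p6 h20.symm h12 h10.symm
      (by grind) h27.symm h62 h67.symm (by grind) (by grind)
    have lab := line ha.symm hb.symm hab h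
    clear par0 par7 line
    have mem : ∀ x, x ≠ p2 → dir p2 p0 ≠ dir p2 x → dir p2 p7 ≠ dir p2 x →
        x = p3 ∨ x = p4 ∨ x = p5 := by
      intro x _ _ _
      rcases cover x with h | h | h | h | h | h | h | h <;> grind
    rcases mem a ha h' h'' with rfl | rfl | rfl <;>
      rcases mem b hb (by grind) (by grind) with rfl | rfl | rfl <;> grind
  have h146 : dir p1 p4 = dir p1 p6 := by
    obtain ⟨a, b, ha, hb, hab, h, h', h''⟩ := H.third p1 p0 p2 p7 p3 h10.symm h12.symm h20.symm
      (by grind) h17.symm h31 h37.symm (by grind) (by grind)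
    have lab := line ha.symm hb.symm hab h
    clear par0 par7 line
    have mem : ∀ x, x ≠ p1 → dir p1 p0 ≠ dir p1 x → dir p1 p7 ≠ dir p1 x →
        x = p4 ∨ x = p5 ∨ x = p6 := by
      intro x _ _ _
      rcases cover x with h | h | h | h | h | h | h | h <;> grind
    rcases mem a ha h' h'' with rfl | rfl | rfl <;>
      rcases mem b hb (by grind) (by grind) with rfl | rfl | rfl <;> grind
  exact ⟨p1, p2, p3, p4, p5, p6, p7, hnd, h012, h034, h056, h713, h745, h726, h235, h146,
    fun z h1 h2 => n0 z h1 h2, by grind, by grind⟩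

end Combinatorics

/-! ### Approximation by rational models, one point at a time. -/

section Density

open Filter Topology

/-- The rational numbers as a subfield of the reals. -/
noncomputable abbrev ratSubfield : Subfield ℝ := (Rat.castHom ℝ).fieldRange

/-- The points of the real plane with rational coordinates. -/
def ratPoints : Set (ℝ × ℝ) := {z | z.1 ∈ ratSubfield ∧ z.2 ∈ ratSubfield}

theorem dense_ratSubfield : Dense (ratSubfield : Set ℝ) := by
  rw [RingHom.coe_fieldRange]
  exact Rat.isDenseEmbedding_coe_real.dense

theorem dense_ratPoints : Dense ratPoints :=
  dense_ratSubfield.prod dense_ratSubfield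

theorem area_mem_ratSubfield {p q r : ℝ × ℝ} (hp : p ∈ ratPoints) (hq : q ∈ ratPoints)
    (hr : r ∈ ratPoints) : area p q r ∈ ratSubfield :=
  sub_mem (mul_mem (sub_mem hq.1 hp.1) (sub_mem hr.2 hp.2))
    (mul_mem (sub_mem hq.2 hp.2) (sub_mem hr.1 hp.1))

theorem affine_param_mem_ratPoints {a b : ℝ × ℝ} {t : ℝ} (ha : a ∈ ratPoints)
    (hb : b ∈ ratPoints) (ht : t ∈ ratSubfield) : a + t • (b - a) ∈ ratPoints :=
  ⟨add_mem ha.1 (mul_mem ht (sub_mem hb.1 ha.1)), add_mem ha.2 (mul_mem ht (sub_mem hb.2 ha.2))⟩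

variable {P : Type*}

/-- The plane configurations that are rational on `s` and have all collinearities that `x` has
on `s`. -/
def rationalModels (x : P → ℝ × ℝ) (s : Set P) : Set (P → ℝ × ℝ) :=
  {y | (∀ p ∈ s, y p ∈ ratPoints) ∧ ∀ a ∈ s, ∀ b ∈ s, ∀ c ∈ s,
    area (x a) (x b) (x c) = 0 → area (y a) (y b) (y c) = 0}

/-- Common core of the three ways to put `p` back: `f` computes its new position from a nearby model
and an auxiliary rational parameter near `w`. Models paired with rational parameters accumulate at
`(x, w)`, and continuity of `f` carries this over to the extended models. -/
theorem mem_closure_rationalModels_of_extension {x : P → ℝ × ℝ} {s : Set P} {p : P} (hp : p ∉ s)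
    (hx : x ∈ closure (rationalModels x s)) {w : ℝ × ℝ}
    {f : (P → ℝ × ℝ) × (ℝ × ℝ) → ℝ × ℝ} (hf : ContinuousAt f (x, w)) (hfx : f (x, w) = x p)
    (H : ∀ᶠ z in 𝓝 (x, w), z.1 ∈ rationalModels x s → z.2 ∈ ratPoints →
      f z ∈ ratPoints ∧ ∀ c ∈ s, ∀ d ∈ s, c ≠ d → area (x p) (x c) (x d) = 0 →
        area (f z) (z.1 c) (z.1 d) = 0) :
    x ∈ closure (rationalModels x (insert p s)) := by
  classical
  set g : (P → ℝ × ℝ) × (ℝ × ℝ) → P → ℝ × ℝ := fun z => Function.update z.1 p (f z) with hg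
  have hgx : g (x, w) = x := by simp [hg, hfx]
  have hgc : Tendsto g (𝓝 (x, w)) (𝓝 x) := by
    have : ContinuousAt g (x, w) := continuousAt_fst.update p hf
    rwa [ContinuousAt, hgx] at this
  have hxw : (x, w) ∈ closure (rationalModels x s ×ˢ ratPoints) := by
    rw [closure_prod_eq]
    exact ⟨hx, dense_ratPoints w⟩
  rw [mem_closure_iff_frequently] at hxw ⊢
  refine hgc.frequently ((hxw.and_eventually H).mono ?_)
  rintro ⟨y, v⟩ ⟨⟨hy, hv⟩, h⟩
  obtain ⟨h1, h2⟩ := h hy hv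
  have hgp : g (y, v) p = f (y, v) := by simp [hg]
  have hgs : ∀ c ∈ s, g (y, v) c = y c := fun c hc => by
    simp [hg, Function.update_of_ne (ne_of_mem_of_not_mem hc hp)]
  have key : ∀ c ∈ s, ∀ d ∈ s, area (x p) (x c) (x d) = 0 →
      area (g (y, v) p) (g (y, v) c) (g (y, v) d) = 0 := by
    intro c hc d hd hcd
    rw [hgp, hgs c hc, hgs d hd]
    by_cases h : c = d
    · rw [h, area_self_right]
    · exact h2 c hc d hd h hcd
  refine ⟨?_, ?_⟩
  · rintro q (rfl | hq)
    · rwa [hgp]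
    · rw [hgs q hq]
      exact hy.1 q hq
  · rintro a (rfl | ha) b (rfl | hb) c (rfl | hc) habc
    · exact area_self_left _ _
    · exact area_self_left _ _
    · exact area_self_outer _ _
    · exact key b hb c hc habc
    · exact area_self_right _ _
    · rw [area_rotate, area_rotate] at habc ⊢
      rw [area_rotate, area_rotate] at habc ⊢
      exact key c hc a ha habc
    · rw [area_rotate, area_rotate] at habc ⊢
      exact key a ha b hb habc
    · rw [hgs a ha, hgs b hb, hgs c hc]
      exact hy.2 a ha b hb c hc habc

variable {x : P → ℝ × ℝ} {s : Set P} {p : P}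

theorem mem_closure_rationalModels_of_free (hp : p ∉ s) (hx : x ∈ closure (rationalModels x s))
    (H : ∀ c ∈ s, ∀ d ∈ s, c ≠ d → area (x p) (x c) (x d) ≠ 0) :
    x ∈ closure (rationalModels x (insert p s)) :=
  mem_closure_rationalModels_of_extension hp hx (w := x p) (f := Prod.snd) continuousAt_snd rfl
    (Eventually.of_forall fun _ _ h => ⟨h, fun c hc d hd hcd h0 => absurd h0 (H c hc d hd hcd)⟩)

/-- If a line of `x` through `p` and `a`, `b` is kept by `y`, and `q` is on the line `y a`, `y b`,
then `q` is on all the lines spanned by points on that line. -/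
theorem area_eq_zero_of_rationalModels (hpx : ∀ c ∈ s, x p ≠ x c) {y : P → ℝ × ℝ}
    (hy : y ∈ rationalModels x s) {a b c d : P} (ha : a ∈ s) (hb : b ∈ s) (hc : c ∈ s)
    (hd : d ∈ s) (hab : area (x p) (x a) (x b) = 0) (hac : area (x p) (x a) (x c) = 0)
    (hcd : area (x p) (x c) (x d) = 0) {q : ℝ × ℝ} (hyab : y a ≠ y b)
    (hq : area (y a) (y b) q = 0) : area q (y c) (y d) = 0 := by
  have hca : area (x p) (x c) (x a) = 0 := by
    rw [area_rotate, area_swap, ← area_rotate, hac, neg_zero]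
  have had : area (x p) (x a) (x d) = 0 :=
    area_eq_zero_of_common_line (hpx c hc) (area_self_outer _ _) hca hcd
  have h1 := hy.2 a ha b hb c hc
    (area_eq_zero_of_common_line (hpx a ha) (area_self_right _ _) hab hac)
  have h2 := hy.2 a ha b hb d hd
    (area_eq_zero_of_common_line (hpx a ha) (area_self_right _ _) hab had)
  exact area_eq_zero_of_common_line hyab hq h1 h2

theorem eventually_apply_ne {c d : P} (h : x c ≠ x d) (w : ℝ × ℝ) :
    ∀ᶠ z : (P → ℝ × ℝ) × (ℝ × ℝ) in 𝓝 (x, w), z.1 c ≠ z.1 d := by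
  have hc : ∀ c : P, Continuous fun z : (P → ℝ × ℝ) × (ℝ × ℝ) => z.1 c := fun c => by fun_prop
  exact (isOpen_ne_fun (hc c) (hc d)).mem_nhds h

theorem mem_closure_rationalModels_of_line (hp : p ∉ s) (hx : x ∈ closure (rationalModels x s))
    (hpx : ∀ c ∈ s, x p ≠ x c) {a b : P} (ha : a ∈ s) (hb : b ∈ s) (hab : x a ≠ x b)
    (hpab : area (x p) (x a) (x b) = 0)
    (H : ∀ c ∈ s, ∀ d ∈ s, c ≠ d → area (x p) (x c) (x d) = 0 → area (x p) (x a) (x c) = 0) :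
    x ∈ closure (rationalModels x (insert p s)) := by
  obtain ⟨t, ht⟩ := exists_affine_param hab (p := x p) (by rw [← area_rotate]; exact hpab)
  -- Only the first coordinate of the parameter is used, as the position along the line.
  refine mem_closure_rationalModels_of_extension hp hx (w := (t, 0))
    (f := fun z => z.1 a + z.2.1 • (z.1 b - z.1 a)) (by fun_prop) ht.symm ?_
  filter_upwards [eventually_apply_ne hab _] with z hz hy hw
  refine ⟨affine_param_mem_ratPoints (hy.1 a ha) (hy.1 b hb) hw.1, fun c hc d hd hcd h0 => ?_⟩
  refine area_eq_zero_of_rationalModels hpx hy ha hb hc hd hpab (H c hc d hd hcd h0) h0 hz ?_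
  rw [area_affine_param, area_self_outer, area_self_right]
  ring

theorem mem_closure_rationalModels_of_two_lines (hp : p ∉ s)
    (hx : x ∈ closure (rationalModels x s)) (hpx : ∀ c ∈ s, x p ≠ x c) {a b a' b' : P}
    (ha : a ∈ s) (hb : b ∈ s) (hab : x a ≠ x b) (ha' : a' ∈ s) (hb' : b' ∈ s)
    (hab' : x a' ≠ x b') (hpab : area (x p) (x a) (x b) = 0)
    (hpab' : area (x p) (x a') (x b') = 0) (haa' : area (x p) (x a) (x a') ≠ 0)
    (H : ∀ c ∈ s, ∀ d ∈ s, c ≠ d → area (x p) (x c) (x d) = 0 →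
      area (x p) (x a) (x c) = 0 ∨ area (x p) (x a') (x c) = 0) :
    x ∈ closure (rationalModels x (insert p s)) := by
  obtain ⟨t, ht⟩ := exists_affine_param hab (p := x p) (by rw [← area_rotate]; exact hpab)
  have h1 : (1 - t) * area (x a') (x b') (x a) + t * area (x a') (x b') (x b) = 0 := by
    rw [← area_affine_param, ← ht, ← area_rotate]; exact hpab'
  -- The two lines are transverse: otherwise `a` would lie on the line `a' b'`, which passes through
  -- `p`, contrary to `haa'`. This keeps the formula for the intersection continuous at `x`.
  have hD : area (x a') (x b') (x a) - area (x a') (x b') (x b) ≠ 0 := by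
    intro h
    have h2 : area (x a') (x b') (x a) = 0 := by linear_combination h1 + t * h
    refine haa' ?_
    exact area_eq_zero_of_common_line hab' (by rw [← area_rotate]; exact hpab') h2
      (area_self_outer _ _)
  have ht' : area (x a') (x b') (x a) / (area (x a') (x b') (x a) - area (x a') (x b') (x b)) = t := by
    field_simp
    linear_combination h1
  refine mem_closure_rationalModels_of_extension hp hx (w := 0)
    (f := fun z => z.1 a + (area (z.1 a') (z.1 b') (z.1 a) /
      (area (z.1 a') (z.1 b') (z.1 a) - area (z.1 a') (z.1 b') (z.1 b))) • (z.1 b - z.1 a))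
    ?_ (by simp only [ht']; exact ht.symm) ?_
  · simp only [area] at hD ⊢
    fun_prop (disch := exact hD)
  have hD' : ∀ᶠ z : (P → ℝ × ℝ) × (ℝ × ℝ) in 𝓝 (x, 0),
      area (z.1 a') (z.1 b') (z.1 a) - area (z.1 a') (z.1 b') (z.1 b) ≠ 0 := by
    refine ContinuousAt.eventually_ne ?_ hD
    simp only [area]
    fun_prop
  filter_upwards [eventually_apply_ne hab _, eventually_apply_ne hab' _, hD'] with z hz hz' hzD hy _
  have rat : ∀ {a b c : P}, a ∈ s → b ∈ s → c ∈ s → area (z.1 a) (z.1 b) (z.1 c) ∈ ratSubfield :=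
    fun ha hb hc => area_mem_ratSubfield (hy.1 _ ha) (hy.1 _ hb) (hy.1 _ hc)
  refine ⟨affine_param_mem_ratPoints (hy.1 a ha) (hy.1 b hb)
    (div_mem (rat ha' hb' ha) (sub_mem (rat ha' hb' ha) (rat ha' hb' hb))),
    fun c hc d hd hcd h0 => ?_⟩
  rcases H c hc d hd hcd h0 with h | h
  · refine area_eq_zero_of_rationalModels hpx hy ha hb hc hd hpab h h0 hz ?_
    rw [area_affine_param, area_self_outer, area_self_right]
    ring
  · refine area_eq_zero_of_rationalModels hpx hy ha' hb' hc hd hpab' h h0 hz' ?_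
    rw [area_affine_param]
    field_simp
    ring

/-! ### From plane configurations to the combinatorics of directions. -/

/-- The points collinear with `p` and `a`, as a direction of the line through `p` and `a`. -/
def lineDir {Q : Type*} (x : Q → ℝ × ℝ) (p a : Q) : Q → Prop :=
  fun b => area (x p) (x a) (x b) = 0

section LineDir

variable {Q : Type*} {x : Q → ℝ × ℝ}

theorem lineDir_eq_iff (hx : Function.Injective x) {p a b : Q} (ha : a ≠ p) (hb : b ≠ p) :
    lineDir x p a = lineDir x p b ↔ area (x p) (x a) (x b) = 0 := by
  refine ⟨fun h => ?_, fun h => ?_⟩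
  · have h' : lineDir x p b b := area_self_right _ _
    rwa [← h] at h'
  · have h' : area (x p) (x b) (x a) = 0 := by
      rw [area_rotate, area_swap, ← area_rotate, h, neg_zero]
    funext c
    exact propext ⟨fun hc => area_eq_zero_of_common_line (hx.ne ha.symm) (area_self_outer _ _) h hc,
      fun hc => area_eq_zero_of_common_line (hx.ne hb.symm) (area_self_outer _ _) h' hc⟩

theorem isDirection_lineDir (hx : Function.Injective x) : IsDirection (lineDir x) := by
  intro p a b hpa hpb hab h
  rw [lineDir_eq_iff hx hpa.symm hpb.symm] at h
  rw [lineDir_eq_iff hx hpa hab.symm, area_swap, h, neg_zero]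

theorem not_threeLinesThroughEachPoint [Fintype Q] [Nonempty Q] (hQ : Fintype.card Q ≤ 8)
    (hx : Function.Injective x) : ¬ ThreeLinesThroughEachPoint (lineDir x) := by
  intro H
  have hd := isDirection_lineDir hx
  obtain ⟨p0⟩ := ‹Nonempty Q›
  have hz : ∀ {p a b : Q}, lineDir x p a = lineDir x p b → a ≠ p → b ≠ p →
      area (x p) (x a) (x b) = 0 := fun h ha hb => (lineDir_eq_iff hx ha hb).1 h
  have hn : ∀ {p a b : Q}, lineDir x p a ≠ lineDir x p b → a ≠ p → b ≠ p →
      area (x p) (x a) (x b) ≠ 0 := fun h ha hb h' => h ((lineDir_eq_iff hx ha hb).2 h')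
  rcases Nat.lt_or_ge (Fintype.card Q) 8 with h8 | h8
  · obtain ⟨p1, p2, p3, p4, p5, p6, hnd, h1, h2, h3, h4, h5, h6, h7, n1, n2, n3, n4, n5⟩ :=
      exists_fano hd H (by omega) p0
    simp only [List.nodup_cons, List.mem_cons, List.not_mem_nil, or_false, not_or] at hnd
    refine fano_not_realizable (hz h1 ?_ ?_) (hz h2 ?_ ?_) (hz h3 ?_ ?_) (hz h4 ?_ ?_)
      (hz h5 ?_ ?_) (hz h6 ?_ ?_) (hz h7 ?_ ?_) (hn n1 ?_ ?_) (hn n3 ?_ ?_) (hn n2 ?_ ?_)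
      (hn n4 ?_ ?_) (hn n5 ?_ ?_) <;> grind
  · obtain ⟨p1, p2, p3, p4, p5, p6, p7, hnd, h1, h2, h3, h4, h5, h6, h7, h8, n0, n1, n2⟩ :=
      exists_moebiusKantor hd H (by omega) p0
    simp only [List.nodup_cons, List.mem_cons, List.not_mem_nil, or_false, not_or] at hnd
    refine moebiusKantor_not_realizable (hz h1 ?_ ?_) (hz h2 ?_ ?_) (hz h3 ?_ ?_) (hz h4 ?_ ?_)
      (hz h5 ?_ ?_) (hz h6 ?_ ?_) (hz h7 ?_ ?_) (hz h8 ?_ ?_) (hn (n0 p2 ?_ ?_) ?_ ?_)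
      (hn (n0 p1 ?_ ?_) ?_ ?_) (hn (n0 p3 ?_ ?_) ?_ ?_) (hn (n0 p4 ?_ ?_) ?_ ?_)
      (hn (n0 p5 ?_ ?_) ?_ ?_) (hn (n0 p6 ?_ ?_) ?_ ?_) (hn n1 ?_ ?_) (hn n2 ?_ ?_) <;> grind

end LineDir

/-- The configurations of at most eight points that are rational and have all collinearities of a
given configuration accumulate at it. -/
theorem mem_closure_rationalModels (x : P → ℝ × ℝ) (s : Finset P) (hs : s.card ≤ 8)
    (hx : Set.InjOn x s) : x ∈ closure (rationalModels x s) := by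
  classical
  induction s using Finset.strongInduction with
  | H s ih =>
  rcases s.eq_empty_or_nonempty with rfl | hne
  · exact subset_closure ⟨by simp, by simp⟩
  by_contra hcl
  have hne' : Nonempty s := hne.to_subtype
  have hinj : Function.Injective fun q : s => x q := fun a b h =>
    Subtype.ext (hx a.2 b.2 h)
  refine not_threeLinesThroughEachPoint (Q := s) (by simpa using hs) hinj ?_
  have base : ∀ p ∈ s, x ∈ closure (rationalModels x (s.erase p : Finset P)) := fun p hp =>
    ih _ (Finset.erase_ssubset hp) ((Finset.card_le_card (Finset.erase_subset _ _)).trans hs)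
      (hx.mono (by simp))
  have hins : ∀ p ∈ s, insert p ((s.erase p : Finset P) : Set P) = s := fun p hp => by
    rw [← Finset.coe_insert, Finset.insert_erase hp]
  have hnot : ∀ p, p ∉ ((s.erase p : Finset P) : Set P) := fun p => by simp
  have hpx : ∀ p ∈ s, ∀ c ∈ ((s.erase p : Finset P) : Set P), x p ≠ x c := fun p hp c hc h => by
    rw [Finset.mem_coe, Finset.mem_erase] at hc
    exact hc.1 (hx hp hc.2 h).symm
  have mem : ∀ {p q : s}, q ≠ p → (q : P) ∈ ((s.erase p : Finset P) : Set P) := fun {p q} h => by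
    simp [h]
  have iff : ∀ {p a b : s}, a ≠ p → b ≠ p → (lineDir (fun q : s => x q) p a =
    lineDir (fun q : s => x q) p b ↔ area (x p) (x a) (x b) = 0) := fun ha hb =>
      lineDir_eq_iff hinj ha hb
  -- The three fields fail precisely when some point lies on no line, only one, or only two; each
  -- failure is the hypothesis of one extension lemma and contradicts `hcl`.
  constructor
  · intro p
    by_contra! h
    refine hcl (hins p p.2 ▸ mem_closure_rationalModels_of_free (hnot p) (base p p.2) ?_)
    intro c hc d hd hcd h0
    rw [Finset.mem_coe, Finset.mem_erase] at hc hd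
    have hc' : (⟨c, hc.2⟩ : s) ≠ p := fun h => hc.1 (congrArg Subtype.val h)
    have hd' : (⟨d, hd.2⟩ : s) ≠ p := fun h => hd.1 (congrArg Subtype.val h)
    exact h _ _ hc' hd' (fun h => hcd (congrArg Subtype.val h)) ((iff hc' hd').2 h0)
  · intro p a b ha hb hab hpab
    by_contra! h
    refine hcl (hins p p.2 ▸ mem_closure_rationalModels_of_line (hnot p) (base p p.2) (hpx p p.2)
      (mem ha) (mem hb) (hinj.ne hab) ((iff ha hb).1 hpab) ?_)
    intro c hc d hd hcd h0
    rw [Finset.mem_coe, Finset.mem_erase] at hc hd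
    have hc' : (⟨c, hc.2⟩ : s) ≠ p := fun h => hc.1 (congrArg Subtype.val h)
    have hd' : (⟨d, hd.2⟩ : s) ≠ p := fun h => hd.1 (congrArg Subtype.val h)
    exact (iff ha hc').1
      (h _ _ hc' hd' (fun h => hcd (congrArg Subtype.val h)) ((iff hc' hd').2 h0))
  · intro p a b a' b' ha hb hab hpab ha' hb' hab' hpab' haa'
    by_contra! h
    refine hcl (hins p p.2 ▸ mem_closure_rationalModels_of_two_lines (hnot p) (base p p.2)
      (hpx p p.2) (mem ha) (mem hb) (hinj.ne hab) (mem ha') (mem hb') (hinj.ne hab')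
      ((iff ha hb).1 hpab) ((iff ha' hb').1 hpab') (fun h => haa' ((iff ha ha').2 h)) ?_)
    intro c hc d hd hcd h0
    rw [Finset.mem_coe, Finset.mem_erase] at hc hd
    have hc' : (⟨c, hc.2⟩ : s) ≠ p := fun h => hc.1 (congrArg Subtype.val h)
    have hd' : (⟨d, hd.2⟩ : s) ≠ p := fun h => hd.1 (congrArg Subtype.val h)
    rw [or_iff_not_imp_left]
    intro hac
    exact (iff ha' hc').1 (h _ _ hc' hd' (fun h => hcd (congrArg Subtype.val h))
      ((iff hc' hd').2 h0) fun h => hac ((iff ha hc').1 h))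

end Density

/-! ### Realizations in coordinates, and arrangements of at most eight points. -/

section Realizations

open Filter Topology

/-- The pair of coordinates of a point of the plane. -/
def coordPair (v : EuclideanSpace ℝ (Fin 2)) : ℝ × ℝ := (v 0, v 1)

theorem coordPair_injective : Function.Injective coordPair := fun v w h => by
  ext i
  fin_cases i
  · exact congrArg Prod.fst h
  · exact congrArg Prod.snd h

theorem collinear_iff_area_eq_zero (p q r : EuclideanSpace ℝ (Fin 2)) :
    Collinear ℝ {p, q, r} ↔ area (coordPair p) (coordPair q) (coordPair r) = 0 := by
  rw [collinear_iff_of_mem (p₀ := p) (by simp)]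
  constructor
  · rintro ⟨v, hv⟩
    obtain ⟨s, rfl⟩ := hv q (by simp)
    obtain ⟨t, rfl⟩ := hv r (by simp)
    simp [area, coordPair]
    ring
  · intro h
    by_cases hpq : p = q
    · subst hpq
      refine ⟨r - p, ?_⟩
      simp only [Set.mem_insert_iff, Set.mem_singleton_iff]
      rintro z (rfl | rfl | rfl)
      · exact ⟨0, by simp⟩
      · exact ⟨0, by simp⟩
      · exact ⟨1, by simp⟩
    · obtain ⟨t, ht⟩ := exists_affine_param (coordPair_injective.ne hpq) h
      refine ⟨q - p, ?_⟩
      simp only [Set.mem_insert_iff, Set.mem_singleton_iff]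
      rintro z (rfl | rfl | rfl)
      · exact ⟨0, by simp⟩
      · exact ⟨1, by simp⟩
      · refine ⟨t, coordPair_injective ?_⟩
        rw [ht]
        ext <;> simp [coordPair] <;> ring

variable {P : Type*}

theorem isRealization_iff_area (A : PointLineArrangement P) [DecidableEq P]
    (x : P → EuclideanSpace ℝ (Fin 2)) :
    A.IsRealization x ↔ Function.Injective x ∧ ∀ a b c, a ≠ b → a ≠ c → b ≠ c →
      (area (coordPair (x a)) (coordPair (x b)) (coordPair (x c)) = 0 ↔
        ∃ B ∈ A.collinearSets, ({a, b, c} : Finset P) ⊆ B) := by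
  have him : ∀ a b c, x '' (({a, b, c} : Finset P) : Set P) = {x a, x b, x c} := by
    intro a b c
    simp [Set.image_insert_eq]
  constructor
  · rintro ⟨h1, h2⟩
    refine ⟨h1, fun a b c hab hac hbc => ?_⟩
    rw [← collinear_iff_area_eq_zero, ← him]
    exact h2 _ (Finset.card_eq_three.2 ⟨a, b, c, hab, hac, hbc, rfl⟩)
  · rintro ⟨h1, h2⟩
    refine ⟨h1, fun T hT => ?_⟩
    obtain ⟨a, b, c, hab, hac, hbc, rfl⟩ := Finset.card_eq_three.1 hT
    rw [him, collinear_iff_area_eq_zero]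
    exact h2 a b c hab hac hbc

theorem IsRealizable.isRational_of_card_le_eight [Fintype P] (hP : Fintype.card P ≤ 8)
    {A : PointLineArrangement P} (hA : A.IsRealizable) : A.IsRational := by
  classical
  obtain ⟨x, hx⟩ := hA
  rw [isRealization_iff_area] at hx
  set X : P → ℝ × ℝ := fun p => coordPair (x p)
  have hX : Function.Injective X := coordPair_injective.comp hx.1
  have hcl := mem_closure_rationalModels X Finset.univ (by simpa using hP) hX.injOn
  have e1 : ∀ᶠ y in 𝓝 X, ∀ a b, X a ≠ X b → y a ≠ y b := by
    simp only [eventually_all]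
    exact fun a b h => (isOpen_ne_fun (continuous_apply a) (continuous_apply b)).mem_nhds h
  have e2 : ∀ᶠ y in 𝓝 X, ∀ a b c, area (X a) (X b) (X c) ≠ 0 → area (y a) (y b) (y c) ≠ 0 := by
    simp only [eventually_all]
    refine fun a b c h => ContinuousAt.eventually_ne ?_ h
    simp only [area]
    fun_prop
  obtain ⟨y, ⟨⟨hyr, hyc⟩, hy1⟩, hy2⟩ :=
    (((mem_closure_iff_frequently.1 hcl).and_eventually e1).and_eventually e2).exists
  have hco : ∀ p, coordPair !₂[(y p).1, (y p).2] = y p := fun p => by simp [coordPair]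
  refine ⟨fun p => !₂[(y p).1, (y p).2], (isRealization_iff_area _ _).2 ⟨fun a b h => ?_, ?_⟩, ?_⟩
  · by_contra hab
    refine hy1 a b (hX.ne hab) ?_
    have := congrArg coordPair h
    simpa only [hco] using this
  · intro a b c hab hac hbc
    simp only [hco]
    rw [← hx.2 a b c hab hac hbc]
    exact ⟨fun h => by_contra fun h' => hy2 a b c h' h,
      hyc a (by simp) b (by simp) c (by simp)⟩
  · intro p i
    obtain ⟨⟨u, hu⟩, ⟨v, hv⟩⟩ := hyr p (by simp)
    fin_cases i
    · exact ⟨u, by simpa using hu.symm⟩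
    · exact ⟨v, by simpa using hv.symm⟩

/-! ### The Perles configuration. -/

theorem area_map {K L : Type*} [CommRing K] [CommRing L] (φ : K →+* L) (p q r : K × K) :
    area (Prod.map φ φ p) (Prod.map φ φ q) (Prod.map φ φ r) = φ (area p q r) := by
  simp [area]

theorem perles_prescribed_iff (T : Finset (Fin 9)) :
    (∃ B ∈ perles.collinearSets, T ⊆ B) ↔
      ∃ B ∈ ([{0, 3, 5, 6}, {0, 2, 7}, {1, 3, 4}, {1, 6, 7}, {2, 4, 5}, {0, 4, 8}, {1, 5, 8},
        {2, 6, 8}, {3, 7, 8}] : List (Finset (Fin 9))), T ⊆ B := by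
  simp only [perles, Set.mem_insert_iff, Set.mem_singleton_iff, List.mem_cons, List.not_mem_nil,
    or_false]

/-- Coordinates of the Perles configuration in `ℤ[√5]`. -/
def perlesPoint : Fin 9 → ℤ√5 × ℤ√5 :=
  ![(0, 0), (⟨40, 10⟩, ⟨75, 5⟩), (⟨165, -55⟩, ⟨-55, 55⟩), (110, 110), (0, 55),
    (⟨55, 11⟩, ⟨55, 11⟩), (55, 55), (⟨-55, 55⟩, 110), (0, 110)]

/-- Working in ℤ[√5] rather than ℝ makes equality decidable, so all triples can be checked by
evaluation. -/
theorem area_perlesPoint : ∀ a b c : Fin 9, a ≠ b → a ≠ c → b ≠ c →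
    (area (perlesPoint a) (perlesPoint b) (perlesPoint c) = 0 ↔
      ∃ B ∈ ([{0, 3, 5, 6}, {0, 2, 7}, {1, 3, 4}, {1, 6, 7}, {2, 4, 5}, {0, 4, 8}, {1, 5, 8},
        {2, 6, 8}, {3, 7, 8}] : List (Finset (Fin 9))), {a, b, c} ⊆ B) := by
  decide +kernel

theorem perlesPoint_injective : Function.Injective perlesPoint := by
  unfold Function.Injective
  decide +kernel

theorem perles_isRealizable : perles.IsRealizable := by
  have hinj : Function.Injective (Zsqrtd.toReal (d := 5) (by norm_num)) :=
    Zsqrtd.toReal_injective (by norm_num) fun n h => by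
      have h1 : n < 3 := by nlinarith
      have h2 : -3 < n := by nlinarith
      interval_cases n <;> omega
  set φ := Zsqrtd.toReal (d := 5) (by norm_num)
  set y : Fin 9 → ℝ × ℝ := fun p => Prod.map φ φ (perlesPoint p) with hy
  have hco : ∀ p, coordPair !₂[(y p).1, (y p).2] = y p := fun p => by simp [coordPair]
  refine ⟨fun p => !₂[(y p).1, (y p).2], (isRealization_iff_area _ _).2 ⟨fun a b h => ?_, ?_⟩⟩
  · have := congrArg coordPair h
    simp only [hco] at this
    exact perlesPoint_injective (hinj.prodMap hinj this)
  · intro a b c hab hac hbc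
    simp only [hco]
    rw [area_map, map_eq_zero_iff φ hinj, perles_prescribed_iff]
    exact area_perlesPoint a b c hab hac hbc

theorem perles_not_isRational : ¬ perles.IsRational := by
  rintro ⟨x, hx, hrat⟩
  rw [isRealization_iff_area] at hx
  choose X hX using hrat
  have hco : ∀ p, coordPair (x p) =
      Prod.map (Rat.castHom ℝ) (Rat.castHom ℝ) (X p 0, X p 1) := fun p => by
    simp [coordPair, hX]
  have key := hx.2
  simp only [hco, area_map, map_eq_zero, perles_prescribed_iff] at key
  set p : Fin 9 → ℚ × ℚ := fun i => (X i 0, X i 1)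
  have z : ∀ {a b c : Fin 9}, _ := fun {a b c} h1 h2 h3 h => (key a b c h1 h2 h3).2 h
  have n : ∀ {a b c : Fin 9}, _ := fun {a b c} h1 h2 h3 h => mt (key a b c h1 h2 h3).1 h
  have n038 : area (p 0) (p 3) (p 8) ≠ 0 := n (by decide) (by decide) (by decide) (by decide)
  have h035 : area (p 0) (p 3) (p 5) = 0 := z (by decide) (by decide) (by decide) (by decide)
  have h036 : area (p 0) (p 3) (p 6) = 0 := z (by decide) (by decide) (by decide) (by decide)
  have h027 : area (p 0) (p 2) (p 7) = 0 := z (by decide) (by decide) (by decide) (by decide)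
  have h134 : area (p 1) (p 3) (p 4) = 0 := z (by decide) (by decide) (by decide) (by decide)
  have h167 : area (p 1) (p 6) (p 7) = 0 := z (by decide) (by decide) (by decide) (by decide)
  have h245 : area (p 2) (p 4) (p 5) = 0 := z (by decide) (by decide) (by decide) (by decide)
  have h048 : area (p 0) (p 4) (p 8) = 0 := z (by decide) (by decide) (by decide) (by decide)
  have h158 : area (p 1) (p 5) (p 8) = 0 := z (by decide) (by decide) (by decide) (by decide)
  have h268 : area (p 2) (p 6) (p 8) = 0 := z (by decide) (by decide) (by decide) (by decide)
  have h378 : area (p 3) (p 7) (p 8) = 0 := z (by decide) (by decide) (by decide) (by decide)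
  have n034 : area (p 0) (p 3) (p 4) ≠ 0 := n (by decide) (by decide) (by decide) (by decide)
  have n037 : area (p 0) (p 3) (p 7) ≠ 0 := n (by decide) (by decide) (by decide) (by decide)
  have n031 : area (p 0) (p 3) (p 1) ≠ 0 := n (by decide) (by decide) (by decide) (by decide)
  have n032 : area (p 0) (p 3) (p 2) ≠ 0 := n (by decide) (by decide) (by decide) (by decide)
  have n348 : area (p 3) (p 4) (p 8) ≠ 0 := n (by decide) (by decide) (by decide) (by decide)
  have n538 : area (p 5) (p 3) (p 8) ≠ 0 := n (by decide) (by decide) (by decide) (by decide)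
  have n638 : area (p 6) (p 3) (p 8) ≠ 0 := n (by decide) (by decide) (by decide) (by decide)
  have n068 : area (p 0) (p 6) (p 8) ≠ 0 := n (by decide) (by decide) (by decide) (by decide)
  obtain ⟨f, g, k, ⟨f0, f3, f8⟩, ⟨g0, g3, g8⟩, ⟨k0, k3, k8⟩, hdet⟩ := exists_barycentric n038
  clear_value p
  simp only [hdet, ne_eq, f0, f3, f8, g0, g3, g8, k0, k3, k8, zero_mul, one_mul, mul_zero, mul_one,
    sub_zero, zero_sub, add_zero, neg_eq_zero]
    at h035 h036 h027 h134 h167 h245 h048 h158 h268 h378 n034 n037 n031 n032 n348 n538 n638 n068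
  -- In the triangle `o₁ o₄ c`, these are the slopes of `o₄ q₁ o₂`, `o₁ o₃ q₄`, `c q₂ o₂` and `c q₃
  -- o₃`. The lines `o₂ q₃ q₄` and `o₃ q₁ q₂` give `e1` and `e2`; eliminating b leaves the quadratic
  -- `e3`.
  obtain ⟨a, ha⟩ : ∃ a, f (p 4) = a * k (p 4) := ⟨f (p 4) / k (p 4), by field_simp⟩
  obtain ⟨b, hb⟩ : ∃ b, g (p 7) = b * k (p 7) := ⟨g (p 7) / k (p 7), by field_simp⟩
  obtain ⟨q, hq⟩ : ∃ q, g (p 5) = q * f (p 5) := ⟨g (p 5) / f (p 5), by field_simp⟩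
  obtain ⟨r, hr⟩ : ∃ r, g (p 6) = r * f (p 6) := ⟨g (p 6) / f (p 6), by field_simp⟩
  have f1 : f (p 1) = a * k (p 1) := mul_left_cancel₀ n034 (by
    linear_combination h134 + k (p 1) * ha)
  have g1 : g (p 1) = q * a * k (p 1) := mul_left_cancel₀ n538 (by
    linear_combination -h158 + f (p 1) * hq + q * f (p 5) * f1)
  have g2 : g (p 2) = b * k (p 2) := mul_left_cancel₀ n037 (by
    linear_combination h027 + k (p 2) * hb)
  have f2 : r * f (p 2) = b * k (p 2) := mul_left_cancel₀ n638 (by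
    linear_combination h268 - f (p 2) * hr + f (p 6) * g2)
  have e1 : a * r - q * a + b = 0 := by
    refine mul_left_cancel₀ (mul_ne_zero (mul_ne_zero n031 n638) n037) ?_
    rw [f1, g1, hr, hb, h036, h378] at h167
    linear_combination h167
  have e2 : -b * q + r * b + a * q * r = 0 := by
    refine mul_left_cancel₀ (mul_ne_zero (mul_ne_zero n032 n034) n538) ?_
    rw [h035, h048, hq, g2, ha] at h245
    linear_combination r * h245 + k (p 4) * q * f (p 5) * f2
  have ha0 : a ≠ 0 := by rintro rfl; simp_all
  have hr0 : r ≠ 0 := by rintro rfl; simp_all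
  have e3 : q ^ 2 - 3 * q * r + r ^ 2 = 0 := by
    refine mul_left_cancel₀ ha0 ?_
    linear_combination -e2 + (r - q) * e1
  -- Completing the square in `e3` makes 5 a rational square.
  have e4 : ((2 * q - 3 * r) / r) ^ 2 = 5 := by
    field_simp
    linear_combination 4 * e3
  refine (Nat.prime_five.irrational_sqrt) ⟨|(2 * q - 3 * r) / r|, ?_⟩
  rw [← Real.sqrt_sq (by positivity : (0 : ℝ) ≤ ((|(2 * q - 3 * r) / r| : ℚ) : ℝ)), ← Rat.cast_pow,
    sq_abs, e4]
  norm_num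

end Realizations

end PointLineArrangement

/-- Every point-line arrangement on at most eight points that is realizable in the real plane is
rational; the Perles configuration is realizable and not rational; so nine is the smallest number
of points of a realizable arrangement that is not rational. -/
theorem mainTheorem1 :
    (∀ (n : ℕ) (_ : n ≤ 8) (A : PointLineArrangement (Fin n)),
        A.IsRealizable → A.IsRational) ∧
      (PointLineArrangement.perles.IsRealizable ∧ ¬ PointLineArrangement.perles.IsRational) ∧
      IsLeast {n : ℕ | ∃ A : PointLineArrangement (Fin n), A.IsRealizable ∧ ¬ A.IsRational} 9 := by
  have small : ∀ (n : ℕ) (_ : n ≤ 8) (A : PointLineArrangement (Fin n)),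
      A.IsRealizable → A.IsRational := fun n hn A hA =>
    hA.isRational_of_card_le_eight (by simpa using hn)
  have perles := And.intro PointLineArrangement.perles_isRealizable
    PointLineArrangement.perles_not_isRational
  refine ⟨small, perles, ⟨_, perles⟩, ?_⟩
  rintro n ⟨A, hA, hA'⟩
  by_contra! h
  exact hA' (small n (by omega) A hA)
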